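/- Let $P(z)=a_0+a_1z+\cdots+a_Nz^N$ be a complex polynomial of degree $N\ge 2$ with $a_0a_N\neq 0$, and let $f(z)=P(e^z)/e^z$. For $t>0$ put $M(t)=\max_{|z|=t}|f(z)|$, and write $M^{\circ n}$ and $f^{\circ n}$ for $n$-th iterates. Let $$A(f)=\{z\in\mathbb{C}:\ \text{there is }\ell\ge 0\text{ such that }|f^{\circ (n+\ell)}(z)|\ge M^{\circ n}(R)\text{ for all }n\ge 0\}$$ be the fast escaping set of $f$, where $R>0$ is any constant such that $M^{\circ n}(R)\to\infty$ as $n\to\infty$. Put $K=\max\{|a_0|,\dots,|a_N|\}$, $K_0=\min\{|a_0|,|a_N|\}$, $$R_3=\log\Big(2+\frac{8K}{K_0}\Big),\qquad R_4=1+\max\Big\{\frac{2K+4}{|a_N|},\ \frac{K}{|a_N|}\Big(\frac{2N^2}{N-1}+1\Big)\Big\},$$ $$R_5=\min\Big\{\frac{|a_0|}{2(KN+2)},\ \frac{1}{2N}\sqrt{\frac{|a_0|}{K}}\Big\},\qquad R_6=\max\{\log R_4,\,-\log R_5\}.$$ Let $r$, $c_1$, $x^*$ be any positive real numbers with $$r\le\frac{1}{4N},\qquad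 c_1\ge\frac{32\sqrt2}{K_0r}+\frac{1}{4K_0^2}+\frac{12\sqrt2}{K_0},\qquad x^*\ge\max\{R_3,\,R_6,\,6\log 2,\,12+2\log c_1\}.$$ Then for every horizontal strip $S=\{z\in\mathbb{C}: a\le \operatorname{Im} z\le a+2\pi\}$, $a\in\mathbb{R}$, of width $2\pi$, $$\mathrm{Area}\big(S\cap A(f)^c\big)\le(4\pi+4r)\Big(x^*+r+8c_1e^{4-x^*/2}\,\frac{r}{1-e^{-r/2}}\Big)<\infty,$$ where $\mathrm{Area}$ is planar Lebesgue measure and $A(f)^c=\mathbb{C}\setminus A(f)$. -/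

import Mathlib

/-- The entire function `f(z) = P(e^z) / e^z`. -/
noncomputable def expFun (P : Polynomial ℂ) (z : ℂ) : ℂ :=
  P.eval (Complex.exp z) / Complex.exp z

/-- The maximal modulus function `M(t, f) = max_{|z| = t} |f z|`
(for continuous `f` and `t ≥ 0` the supremum is attained, the circle being compact). -/
noncomputable def maxModulus (f : ℂ → ℂ) (t : ℝ) : ℝ :=
  sSup ((fun z : ℂ => ‖f z‖) '' Metric.sphere (0 : ℂ) t)

/-- The fast escaping set `A(f)`, written with the radius `R`:
the points `z` for which some `ℓ` satisfies `|f^(n+ℓ)(z)| ≥ M^n(R)` for all `n`.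
It is to be used with `R > 0` such that `M^n(R) → ∞`. -/
def fastEscapingSet (f : ℂ → ℂ) (R : ℝ) : Set ℂ :=
  {z | ∃ l : ℕ, ∀ n : ℕ, (maxModulus f)^[n] R ≤ ‖f^[n + l] z‖}

/-- The closed horizontal strip `a ≤ Im z ≤ a + 2π` of width `2π`. -/
def horizontalStrip (a : ℝ) : Set ℂ :=
  {z | a ≤ z.im ∧ z.im ≤ a + 2 * Real.pi}

/-- `K = max {|a_0|, …, |a_N|}`, where `N` is the degree of `P`. -/
noncomputable def coeffMax (P : Polynomial ℂ) : ℝ :=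
  (Finset.range (P.natDegree + 1)).sup' Finset.nonempty_range_add_one (fun i => ‖P.coeff i‖)

/-- `K₀ = min {|a_0|, |a_N|}`, where `N` is the degree of `P`. -/
noncomputable def coeffMin (P : Polynomial ℂ) : ℝ :=
  min ‖P.coeff 0‖ ‖P.coeff P.natDegree‖

/-- `R₃ = log (2 + 8 K / K₀)`. -/
noncomputable def constR3 (P : Polynomial ℂ) : ℝ :=
  Real.log (2 + 8 * coeffMax P / coeffMin P)

/-- `R₄ = 1 + max {(2K + 4) / |a_N|, (K / |a_N|) (2N² / (N - 1) + 1)}`. -/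
noncomputable def constR4 (P : Polynomial ℂ) : ℝ :=
  1 + max ((2 * coeffMax P + 4) / ‖P.coeff P.natDegree‖)
    (coeffMax P / ‖P.coeff P.natDegree‖ *
      (2 * (P.natDegree : ℝ) ^ 2 / ((P.natDegree : ℝ) - 1) + 1))

/-- `R₅ = min {|a_0| / (2 (K N + 2)), (1 / (2N)) √(|a_0| / K)}`. -/
noncomputable def constR5 (P : Polynomial ℂ) : ℝ :=
  min (‖P.coeff 0‖ / (2 * (coeffMax P * (P.natDegree : ℝ) + 2)))
    (1 / (2 * (P.natDegree : ℝ)) * Real.sqrt (‖P.coeff 0‖ / coeffMax P))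

/-- `R₆ = max {log R₄, - log R₅}`. -/
noncomputable def constR6 (P : Polynomial ℂ) : ℝ :=
  max (Real.log (constR4 P)) (-Real.log (constR5 P))

/-- `c₀ = 32√2 / (K₀ r) + 1 / (4 K₀²) + 12√2 / K₀`. -/
noncomputable def constC0 (P : Polynomial ℂ) (r : ℝ) : ℝ :=
  32 * Real.sqrt 2 / (coeffMin P * r) + 1 / (4 * coeffMin P ^ 2) + 12 * Real.sqrt 2 / coeffMin P

/-- The area bound `(4π + 4r) (x* + r + 8 c₁ e^(4 - x*/2) r / (1 - e^(-r/2)))`. -/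
noncomputable def areaBound (r c₁ x : ℝ) : ℝ :=
  (4 * Real.pi + 4 * r) *
    (x + r + 8 * c₁ * Real.exp (4 - x / 2) * (r / (1 - Real.exp (-r / 2))))

open MeasureTheory Set

/-! Call w slow if |Re f(w)| < 4e^{|Re w|/2}. An orbit without slow points has |Re| growing at least
like iterates of 4e^{t/2}, whereas M(t) ≤ Ce^{(N-1)t}. The loss in the exponent is only a constant
factor, so after a time shift |Re| dominates a multiple of M^n(R)
(`mem_fastEscapingSet_of_notMem_slowBefore`). Hence it suffices to bound the area of the points
whose orbit meets a slow point.

On a square of side r far from the imaginary axis, f' is within (3/4)|L| of a constant L with |L| ≥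
K₀e^{|Re w|} (`exists_norm_expFunDeriv_sub_le`). So f is injective there and expands areas by at
least |L|²/16. With y = e^{|Re w|/2}, the slow points map into a box of width O(y) and height
O(|L|r), which gives them density O(1/y). The other points map to |Re| ≥ 3y inside a box covered by
O(|L|²) squares, where the inductive density bound is O(e^{-3y/2}). The bound Tr²/y therefore
reproduces itself with the same T for every number of steps
(`volume_cornerSquare_inter_slowBefore_le`). Summing over the squares of a strip gives a geometric
series. -/

/-! ### Area distortion of nearly linear holomorphic maps -/

theorem Complex.volume_reProdIm {s t : Set ℝ} (hs : MeasurableSet s) (ht : MeasurableSet t) :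
    volume (s ×ℂ t) = volume s * volume t := by
  have h : s ×ℂ t = Complex.measurableEquivRealProd ⁻¹' (s ×ˢ t) := by
    ext z
    simp [Complex.mem_reProdIm, Complex.measurableEquivRealProd_apply]
  rw [h, Complex.volume_preserving_equiv_real_prod.measure_preimage (hs.prod ht).nullMeasurableSet,
    Measure.volume_eq_prod, Measure.prod_prod]

theorem ContinuousLinearMap.det_restrictScalars_toSpanSingleton (c : ℂ) :
    ((ContinuousLinearMap.toSpanSingleton ℂ c).restrictScalars ℝ).det = ‖c‖ ^ 2 := by
  simp [ContinuousLinearMap.det, LinearMap.det_restrictScalars, Algebra.norm_complex_eq,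
    Complex.normSq_eq_norm_sq]

/-- An injective holomorphic map whose derivative has modulus at least `c` expands areas by at
least `c ^ 2`. -/
theorem ofReal_sq_mul_volume_le_volume_image {f f' : ℂ → ℂ} {s : Set ℂ} {c : ℝ}
    (hs : MeasurableSet s) (hf : ∀ z ∈ s, HasDerivAt f (f' z) z) (hinj : InjOn f s) (hc : 0 ≤ c)
    (hbound : ∀ z ∈ s, c ≤ ‖f' z‖) :
    ENNReal.ofReal (c ^ 2) * volume s ≤ volume (f '' s) := by
  rw [← lintegral_abs_det_fderiv_eq_addHaar_image volume hs
    (fun z hz => ((hf z hz).hasFDerivAt.restrictScalars ℝ).hasFDerivWithinAt) hinj,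
    ← setLIntegral_const]
  refine setLIntegral_mono' hs fun z hz => ENNReal.ofReal_le_ofReal ?_
  rw [ContinuousLinearMap.det_restrictScalars_toSpanSingleton, abs_of_nonneg (by positivity)]
  exact pow_le_pow_left₀ hc (hbound z hz) 2

/-- A holomorphic map with derivative close to the constant `L` on a convex set is close to the
linear map with slope `L`. -/
theorem norm_image_sub_sub_mul_le {f f' : ℂ → ℂ} {s : Set ℂ} {L : ℂ} {C : ℝ}
    (hs : Convex ℝ s) (hf : ∀ z ∈ s, HasDerivAt f (f' z) z) (hL : ∀ z ∈ s, ‖f' z - L‖ ≤ C)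
    {z w : ℂ} (hz : z ∈ s) (hw : w ∈ s) : ‖f w - f z - L * (w - z)‖ ≤ C * ‖w - z‖ := by
  have := hs.norm_image_sub_le_of_norm_hasDerivWithin_le (f := fun u => f u - L * u)
    (f' := fun u => f' u - L) (C := C)
    (fun u hu => ((hf u hu).sub (by simpa using (hasDerivAt_id u).const_mul L)).hasDerivWithinAt)
    hL hz hw
  calc ‖f w - f z - L * (w - z)‖ = ‖(f w - L * w) - (f z - L * z)‖ := by ring_nf
    _ ≤ _ := this

/-- If `f'` is close to `L ≠ 0` on a convex set `s`, then `f` contracts areas of preimages. -/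
theorem volume_le_of_norm_deriv_sub_le {f f' : ℂ → ℂ} {s t T : Set ℂ} {L : ℂ}
    (hs : Convex ℝ s) (hf : ∀ z, HasDerivAt f (f' z) z) (hL0 : L ≠ 0)
    (hL : ∀ z ∈ s, ‖f' z - L‖ ≤ 3 / 4 * ‖L‖) (ht : MeasurableSet t) (hts : t ⊆ s)
    (hT : MapsTo f t T) : volume t ≤ ENNReal.ofReal (16 / ‖L‖ ^ 2) * volume T := by
  have hL' : 0 < ‖L‖ := norm_pos_iff.2 hL0
  -- A collision f z = f w would give |L||w - z| ≤ (3/4)|L||w - z|.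
  have hinj : InjOn f t := by
    intro z hz w hw h
    by_contra hne
    have h1 := norm_image_sub_sub_mul_le hs (fun u _ => hf u) hL (hts hz) (hts hw)
    rw [h, sub_self, zero_sub, norm_neg, norm_mul] at h1
    have h2 : 0 < ‖w - z‖ := norm_pos_iff.2 (sub_ne_zero.2 (Ne.symm hne))
    nlinarith [mul_pos hL' h2]
  have hbound : ∀ z ∈ t, ‖L‖ / 4 ≤ ‖f' z‖ := by
    intro z hz
    have h1 := hL z (hts hz)
    have h2 := norm_sub_norm_le L (L - f' z)
    rw [norm_sub_rev L (f' z)] at h2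
    have h3 : L - (L - f' z) = f' z := by ring
    rw [h3] at h2
    linarith
  have h := ofReal_sq_mul_volume_le_volume_image ht (fun z _ => hf z) hinj (by positivity) hbound
  have h1 : ENNReal.ofReal (16 / ‖L‖ ^ 2) * ENNReal.ofReal ((‖L‖ / 4) ^ 2) = 1 := by
    rw [← ENNReal.ofReal_mul (by positivity), ← ENNReal.ofReal_one]
    congr 1
    field_simp
    norm_num
  calc volume t = ENNReal.ofReal (16 / ‖L‖ ^ 2) * (ENNReal.ofReal ((‖L‖ / 4) ^ 2) * volume t) := by
        rw [← mul_assoc, h1, one_mul]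
    _ ≤ ENNReal.ofReal (16 / ‖L‖ ^ 2) * volume T := by
        gcongr
        exact h.trans (measure_mono hT.image_subset)

/-! ### Squares and grid coverings -/

/-- The closed axis-parallel square of side `r` with lower left corner `p`. -/
def cornerSquare (p : ℂ) (r : ℝ) : Set ℂ :=
  Icc p.re (p.re + r) ×ℂ Icc p.im (p.im + r)

theorem mem_cornerSquare {p z : ℂ} {r : ℝ} : z ∈ cornerSquare p r ↔
    (p.re ≤ z.re ∧ z.re ≤ p.re + r) ∧ p.im ≤ z.im ∧ z.im ≤ p.im + r := Iff.rfl

theorem measurableSet_cornerSquare (p : ℂ) (r : ℝ) : MeasurableSet (cornerSquare p r) :=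
  (isClosed_Icc.reProdIm isClosed_Icc).measurableSet

theorem convex_cornerSquare (p : ℂ) (r : ℝ) : Convex ℝ (cornerSquare p r) :=
  ((convex_Icc _ _).linear_preimage Complex.reLm).inter
    ((convex_Icc _ _).linear_preimage Complex.imLm)

/-- The diagonal is √2 r; 3/2 is a rational substitute for √2. -/
theorem norm_sub_le_of_mem_cornerSquare {p z w : ℂ} {r : ℝ} (hr : 0 ≤ r)
    (hz : z ∈ cornerSquare p r) (hw : w ∈ cornerSquare p r) : ‖z - w‖ ≤ 3 / 2 * r := by
  rw [mem_cornerSquare] at hz hw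
  refine abs_le_of_sq_le_sq' ?_ (by positivity) |>.2
  rw [← Complex.normSq_eq_norm_sq, Complex.normSq_apply, Complex.sub_re, Complex.sub_im]
  nlinarith [abs_le.2 (⟨by linarith, by linarith⟩ : -r ≤ z.re - w.re ∧ z.re - w.re ≤ r),
    abs_le.2 (⟨by linarith, by linarith⟩ : -r ≤ z.im - w.im ∧ z.im - w.im ≤ r),
    sq_abs (z.re - w.re), sq_abs (z.im - w.im), abs_nonneg (z.re - w.re), abs_nonneg (z.im - w.im)]

theorem exists_nat_mul_le {r d t : ℝ} (hr : 0 < r) (h0 : 0 ≤ t) (hd : t ≤ d) :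
    ∃ i < ⌊d / r⌋₊ + 1, i * r ≤ t ∧ t ≤ i * r + r := by
  refine ⟨⌊t / r⌋₊, Nat.lt_succ_of_le (Nat.floor_le_floor (by gcongr)), ?_, ?_⟩
  · exact (le_div_iff₀ hr).1 (Nat.floor_le (by positivity))
  · have := (div_lt_iff₀ hr).1 (Nat.lt_floor_add_one (t / r))
    linarith

theorem floor_add_one_mul_le {r d : ℝ} (hr : 0 < r) (hd : 0 ≤ d) :
    ((⌊d / r⌋₊ + 1 : ℕ) : ℝ) * r ≤ d + r := by
  have := (le_div_iff₀ hr).1 (Nat.floor_le (show 0 ≤ d / r by positivity))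
  push_cast
  linarith

/-- A box of side `d` is covered by `(⌊d / r⌋ + 1) ^ 2` squares of side `r`. -/
theorem volume_box_inter_le {r d : ℝ} (hr : 0 < r) {B : Set ℂ} {b : ENNReal}
    (hB : ∀ p, volume (cornerSquare p r ∩ B) ≤ b) (q : ℂ) :
    volume (cornerSquare q d ∩ B) ≤ ((⌊d / r⌋₊ + 1 : ℕ) : ENNReal) ^ 2 * b := by
  set n := ⌊d / r⌋₊ + 1 with hn
  have hsub : cornerSquare q d ∩ B ⊆ ⋃ i ∈ Finset.range n, ⋃ j ∈ Finset.range n,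
      cornerSquare (⟨q.re + i * r, q.im + j * r⟩ : ℂ) r ∩ B := by
    rintro z ⟨hz, hzB⟩
    rw [mem_cornerSquare] at hz
    obtain ⟨i, hi, hi1, hi2⟩ := exists_nat_mul_le hr (sub_nonneg.2 hz.1.1)
      (by linarith [hz.1.2] : z.re - q.re ≤ d)
    obtain ⟨j, hj, hj1, hj2⟩ := exists_nat_mul_le hr (sub_nonneg.2 hz.2.1)
      (by linarith [hz.2.2] : z.im - q.im ≤ d)
    simp only [mem_iUnion, Finset.mem_range]
    refine ⟨i, hi, j, hj, ?_, hzB⟩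
    rw [mem_cornerSquare]
    dsimp only
    refine ⟨⟨?_, ?_⟩, ?_, ?_⟩ <;> linarith
  calc volume (cornerSquare q d ∩ B) ≤ _ := measure_mono hsub
    _ ≤ ∑ i ∈ Finset.range n, volume (⋃ j ∈ Finset.range n,
          cornerSquare (⟨q.re + i * r, q.im + j * r⟩ : ℂ) r ∩ B) := measure_biUnion_finset_le _ _
    _ ≤ ∑ i ∈ Finset.range n, ∑ j ∈ Finset.range n, b := by
        gcongr with i hi
        exact (measure_biUnion_finset_le _ _).trans (Finset.sum_le_sum fun j _ => hB _)
    _ = (n : ENNReal) ^ 2 * b := by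
        simp [Finset.sum_const, sq, mul_assoc]

/-! ### Size and derivative of the exponential sum -/

theorem norm_coeff_le_coeffMax (P : Polynomial ℂ) {j : ℕ} (hj : j ∈ Finset.range (P.natDegree + 1)) :
    ‖P.coeff j‖ ≤ coeffMax P :=
  Finset.le_sup' (fun i => ‖P.coeff i‖) hj

/-- The derivative of `expFun P`, as an exponential sum. -/
noncomputable def expFunDeriv (P : Polynomial ℂ) (z : ℂ) : ℂ :=
  ∑ j ∈ Finset.range (P.natDegree + 1), ((j : ℂ) - 1) * P.coeff j * Complex.exp (((j : ℂ) - 1) * z)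

theorem expFun_eq_sum (P : Polynomial ℂ) (z : ℂ) : expFun P z =
    ∑ j ∈ Finset.range (P.natDegree + 1), P.coeff j * Complex.exp (((j : ℂ) - 1) * z) := by
  rw [expFun, Polynomial.eval_eq_sum_range, Finset.sum_div]
  refine Finset.sum_congr rfl fun j _ => ?_
  rw [sub_mul, one_mul, Complex.exp_sub, Complex.exp_nat_mul, mul_div_assoc]

theorem hasDerivAt_expFun (P : Polynomial ℂ) (z : ℂ) :
    HasDerivAt (expFun P) (expFunDeriv P z) z := by
  rw [funext (expFun_eq_sum P), expFunDeriv]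
  refine HasDerivAt.fun_sum fun j _ => ?_
  have h : HasDerivAt (fun z : ℂ => ((j : ℂ) - 1) * z) ((j : ℂ) - 1) z := by
    simpa using (hasDerivAt_id z).const_mul ((j : ℂ) - 1)
  exact (h.cexp.const_mul (P.coeff j)).congr_deriv (by ring)

theorem norm_exp_natCast_sub_one_mul (j : ℕ) (z : ℂ) :
    ‖Complex.exp (((j : ℂ) - 1) * z)‖ = Real.exp z.re ^ j / Real.exp z.re := by
  rw [Complex.norm_exp, ← Real.exp_nat_mul, ← Real.exp_sub]
  congr 1
  simp [Complex.mul_re, sub_mul]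

theorem maxModulus_expFun_le (P : Polynomial ℂ) (hdeg : 2 ≤ P.natDegree) (t : ℝ) :
    maxModulus (expFun P) t ≤
      (P.natDegree + 1) * coeffMax P * Real.exp ((P.natDegree - 1) * t) := by
  have hK : 0 ≤ coeffMax P := (norm_nonneg _).trans
    (norm_coeff_le_coeffMax P (Finset.mem_range.2 (Nat.succ_pos P.natDegree)))
  -- For t < 0 the sphere is empty and the supremum is 0, so the bound holds for every real t.
  refine Real.sSup_le ?_ (by positivity)
  rintro _ ⟨z, hz, rfl⟩
  have hz' : |z.re| ≤ t := (Complex.abs_re_le_norm z).trans (by simpa using hz.le)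
  have hN : (2 : ℝ) ≤ P.natDegree := by exact_mod_cast hdeg
  dsimp only
  rw [expFun_eq_sum]
  calc _ ≤ ∑ j ∈ Finset.range (P.natDegree + 1),
        coeffMax P * Real.exp ((P.natDegree - 1) * t) := by
        refine norm_sum_le_of_le _ fun j hj => ?_
        rw [norm_mul]
        refine mul_le_mul (norm_coeff_le_coeffMax P hj) ?_ (norm_nonneg _) hK
        rw [Complex.norm_exp, Real.exp_le_exp]
        have h1 : (((j : ℂ) - 1) * z).re = ((j : ℝ) - 1) * z.re := by simp [Complex.mul_re]
        rw [h1]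
        have hj' : (j : ℝ) ≤ P.natDegree := by
          exact_mod_cast Nat.lt_succ_iff.1 (Finset.mem_range.1 hj)
        have hj0 : (0 : ℝ) ≤ j := j.cast_nonneg
        calc ((j : ℝ) - 1) * z.re ≤ |(j : ℝ) - 1| * |z.re| := by
              rw [← abs_mul]; exact le_abs_self _
          _ ≤ (P.natDegree - 1) * t := by
              refine mul_le_mul (abs_le.2 ⟨by linarith, by linarith⟩) hz' (abs_nonneg _)
                (by linarith)
    _ = _ := by
        rw [Finset.sum_const, Finset.card_range, nsmul_eq_mul]
        push_cast
        ring

theorem maxModulus_nonneg (f : ℂ → ℂ) (t : ℝ) : 0 ≤ maxModulus f t := by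
  refine Real.sSup_nonneg ?_
  rintro _ ⟨z, -, rfl⟩
  exact norm_nonneg _

theorem geom_sum_div_le {W : ℝ} (hW : 1 < W) (n : ℕ) :
    ∑ j ∈ Finset.range n, W ^ j / W ≤ W ^ n / W / (W - 1) := by
  rw [← Finset.sum_div, geom_sum_eq hW.ne', div_right_comm]
  have : 0 < W - 1 := by linarith
  gcongr
  linarith

/-- Far to the right, the derivative of `expFun P` is close to its top term. -/
theorem norm_expFunDeriv_sub_le_of_constR4_le (P : Polynomial ℂ) (hdeg : 2 ≤ P.natDegree)
    {z : ℂ} (hz : constR4 P ≤ Real.exp z.re) :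
    ‖expFunDeriv P z - ((P.natDegree : ℂ) - 1) * P.coeff P.natDegree *
        Complex.exp (((P.natDegree : ℂ) - 1) * z)‖ ≤
      1 / 8 * ‖((P.natDegree : ℂ) - 1) * P.coeff P.natDegree *
        Complex.exp (((P.natDegree : ℂ) - 1) * z)‖ := by
  have hlead : P.coeff P.natDegree ≠ 0 := by
    have : P ≠ 0 := by rintro rfl; simp at hdeg
    simpa using this
  have hA : 0 < ‖P.coeff P.natDegree‖ := norm_pos_iff.2 hlead
  have hKA := norm_coeff_le_coeffMax P (Finset.self_mem_range_succ P.natDegree)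
  have hK : 0 < coeffMax P := hA.trans_le hKA
  have hN : (2 : ℝ) ≤ P.natDegree := by exact_mod_cast hdeg
  set N := P.natDegree with hNdef
  set W := Real.exp z.re
  -- Comes from the second entry of `constR4`, as 2N² ≥ 7(N - 1). It makes the geometric sum of the
  -- lower terms at most 1/8 of the top term.
  have hW1 : coeffMax P / ‖P.coeff N‖ * 8 ≤ W - 1 := by
    have h1 : (8 : ℝ) ≤ 2 * (N : ℝ) ^ 2 / ((N : ℝ) - 1) + 1 := by
      have : (7 : ℝ) ≤ 2 * (N : ℝ) ^ 2 / ((N : ℝ) - 1) := by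
        rw [le_div_iff₀ (by linarith)]
        nlinarith [sq_nonneg ((N : ℝ) - 2)]
      linarith
    have h2 : 1 + coeffMax P / ‖P.coeff N‖ * (2 * (N : ℝ) ^ 2 / ((N : ℝ) - 1) + 1) ≤ W := by
      refine le_trans ?_ hz
      rw [constR4]
      gcongr
      exact le_max_right _ _
    have h3 : coeffMax P / ‖P.coeff N‖ * 8 ≤
        coeffMax P / ‖P.coeff N‖ * (2 * (N : ℝ) ^ 2 / ((N : ℝ) - 1) + 1) := by gcongr
    linarith
  have hW0 : 0 < W - 1 := lt_of_lt_of_le (by positivity) hW1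
  have hW : 1 < W := by linarith
  have hnormN : ‖((N : ℂ) - 1)‖ = N - 1 := by
    rw [← Complex.ofReal_natCast, ← Complex.ofReal_one, ← Complex.ofReal_sub, Complex.norm_real,
      Real.norm_of_nonneg (by linarith)]
  rw [expFunDeriv, ← hNdef, Finset.sum_range_succ, add_sub_cancel_right, norm_mul, norm_mul,
    hnormN, norm_exp_natCast_sub_one_mul]
  calc _ ≤ ∑ j ∈ Finset.range N, ((N : ℝ) - 1) * coeffMax P * (W ^ j / W) := by
        refine norm_sum_le_of_le _ fun j hj => ?_
        have hj' : (j : ℝ) + 1 ≤ N := by exact_mod_cast Finset.mem_range.1 hj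
        have hj0 : (0 : ℝ) ≤ j := j.cast_nonneg
        rw [norm_mul, norm_mul, norm_exp_natCast_sub_one_mul]
        gcongr
        · linarith
        · rw [← Complex.ofReal_natCast, ← Complex.ofReal_one, ← Complex.ofReal_sub,
            Complex.norm_real, Real.norm_eq_abs]
          exact abs_le.2 ⟨by linarith, by linarith⟩
        · exact norm_coeff_le_coeffMax P
            (Finset.mem_range.2 ((Finset.mem_range.1 hj).trans (Nat.lt_succ_self _)))
    _ = ((N : ℝ) - 1) * coeffMax P * ∑ j ∈ Finset.range N, W ^ j / W := by rw [Finset.mul_sum]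
    _ ≤ ((N : ℝ) - 1) * coeffMax P * (W ^ N / W / (W - 1)) := by
        gcongr
        · have : (0 : ℝ) ≤ N - 1 := by linarith
          positivity
        · exact geom_sum_div_le hW N
    _ = ((N : ℝ) - 1) * (W ^ N / W) * (coeffMax P / (W - 1)) := by ring
    _ ≤ ((N : ℝ) - 1) * (W ^ N / W) * (‖P.coeff N‖ / 8) := by
        have : (0 : ℝ) ≤ N - 1 := by linarith
        gcongr ?_ * ?_
        rw [div_le_div_iff₀ hW0 (by norm_num)]
        rw [div_mul_eq_mul_div, div_le_iff₀ hA] at hW1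
        linarith
    _ = _ := by ring

/-- Far to the left, the derivative of `expFun P` is close to its bottom term. -/
theorem norm_expFunDeriv_sub_le_of_le_constR5 (P : Polynomial ℂ) (hdeg : 2 ≤ P.natDegree)
    (hP0 : P.coeff 0 ≠ 0) {z : ℂ} (hz : Real.exp z.re ≤ constR5 P) :
    ‖expFunDeriv P z - -1 * P.coeff 0 * Complex.exp (-1 * z)‖ ≤
      1 / 8 * ‖-1 * P.coeff 0 * Complex.exp (-1 * z)‖ := by
  have hA : 0 < ‖P.coeff 0‖ := norm_pos_iff.2 hP0
  have hKA := norm_coeff_le_coeffMax P (Finset.mem_range.2 (Nat.succ_pos P.natDegree))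
  have hK : 0 < coeffMax P := hA.trans_le hKA
  have hN : (2 : ℝ) ≤ P.natDegree := by exact_mod_cast hdeg
  set N := P.natDegree with hNdef
  have hexp : ‖Complex.exp (-1 * z)‖ = (Real.exp z.re)⁻¹ := by
    rw [Complex.norm_exp, ← Real.exp_neg]
    simp
  set W := Real.exp z.re with hWdef
  have hWpos : 0 < W := Real.exp_pos _
  have hWs : W ≤ 1 / (2 * (N : ℝ)) * Real.sqrt (‖P.coeff 0‖ / coeffMax P) :=
    hz.trans (min_le_right _ _)
  have hW1 : W ≤ 1 := by
    refine hWs.trans (mul_le_one₀ ?_ (Real.sqrt_nonneg _) ?_)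
    · rw [div_le_one (by positivity)]
      linarith
    · rw [Real.sqrt_le_one]
      exact (div_le_one hK).2 hKA
  -- The square of the second bound in `constR5`; with ∑ j ≤ N²/2 it yields the factor 1/8.
  have hW2 : W ^ 2 * coeffMax P * (4 * (N : ℝ) ^ 2) ≤ ‖P.coeff 0‖ := by
    have h1 : W ^ 2 ≤ (1 / (2 * (N : ℝ)) * Real.sqrt (‖P.coeff 0‖ / coeffMax P)) ^ 2 :=
      pow_le_pow_left₀ hWpos.le hWs 2
    rw [mul_pow, Real.sq_sqrt (by positivity)] at h1
    calc W ^ 2 * coeffMax P * (4 * (N : ℝ) ^ 2) ≤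
        ((1 / (2 * (N : ℝ))) ^ 2 * (‖P.coeff 0‖ / coeffMax P)) * coeffMax P *
          (4 * (N : ℝ) ^ 2) := by gcongr
      _ = ‖P.coeff 0‖ := by field_simp; norm_num
  have hsplit : expFunDeriv P z - -1 * P.coeff 0 * Complex.exp (-1 * z) =
      ∑ j ∈ Finset.range N, (j : ℂ) * P.coeff (j + 1) * Complex.exp ((j : ℂ) * z) := by
    rw [expFunDeriv, ← hNdef, Finset.sum_range_succ', Nat.cast_zero, zero_sub,
      add_sub_cancel_right]
    simp
  have hgauss : ∑ j ∈ Finset.range N, (j : ℝ) ≤ (N : ℝ) ^ 2 / 2 := by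
    clear_value N
    clear * -
    induction N with
    | zero => simp
    | succ n ih =>
      rw [Finset.sum_range_succ]
      push_cast
      linarith
  rw [hsplit, norm_mul, norm_mul, hexp, norm_neg, norm_one, one_mul]
  calc _ ≤ ∑ j ∈ Finset.range N, (j : ℝ) * (coeffMax P * W) := by
        refine norm_sum_le_of_le _ fun j hj => ?_
        rcases j.eq_zero_or_pos with rfl | hj0
        · simp
        rw [norm_mul, norm_mul, Complex.norm_natCast, mul_assoc]
        gcongr
        · exact norm_coeff_le_coeffMax P
            (Finset.mem_range.2 (Nat.succ_lt_succ (Finset.mem_range.1 hj)))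
        · have h1 : ((j : ℂ) * z).re = j * z.re := by simp [Complex.mul_re]
          rw [Complex.norm_exp, h1, Real.exp_nat_mul]
          exact pow_le_of_le_one hWpos.le hW1 hj0.ne'
    _ = (∑ j ∈ Finset.range N, (j : ℝ)) * (coeffMax P * W) := by rw [Finset.sum_mul]
    _ ≤ (N : ℝ) ^ 2 / 2 * (coeffMax P * W) := by gcongr
    _ = 1 / 8 * (W ^ 2 * coeffMax P * (4 * (N : ℝ) ^ 2) * W⁻¹) := by
        field_simp
        norm_num
    _ ≤ _ := by gcongr

/-- A function close to a pure exponential has small relative oscillation on small discs. -/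
theorem norm_sub_le_of_norm_sub_exp_le {c m z w y : ℂ} (hm : ‖m * (z - w)‖ ≤ 3 / 8)
    (hy : ‖y - c * Complex.exp (m * z)‖ ≤ 1 / 8 * ‖c * Complex.exp (m * z)‖) :
    ‖y - c * Complex.exp (m * w)‖ ≤ 3 / 4 * ‖c * Complex.exp (m * w)‖ := by
  set u := m * (z - w) with hu
  set g := c * Complex.exp (m * w) with hg
  have hexp : c * Complex.exp (m * z) = g * Complex.exp u := by
    rw [hg, mul_assoc, ← Complex.exp_add, hu]
    ring_nf
  -- 33/64 = 3/8 + (3/8)².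
  have h1 : ‖Complex.exp u - 1‖ ≤ 33 / 64 := by
    have h2 := Complex.norm_exp_sub_one_sub_id_le (hm.trans (by norm_num))
    have h3 : ‖Complex.exp u - 1‖ ≤ ‖Complex.exp u - 1 - u‖ + ‖u‖ := by
      simpa using norm_add_le (Complex.exp u - 1 - u) u
    nlinarith [norm_nonneg u]
  have h4 : ‖Complex.exp u‖ ≤ 97 / 64 := by
    have := norm_add_le (Complex.exp u - 1) 1
    rw [sub_add_cancel, norm_one] at this
    linarith
  rw [hexp, norm_mul] at hy
  calc ‖y - g‖ = ‖(y - g * Complex.exp u) + g * (Complex.exp u - 1)‖ := by ring_nf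
    _ ≤ ‖y - g * Complex.exp u‖ + ‖g‖ * ‖Complex.exp u - 1‖ := by
        rw [← norm_mul]; exact norm_add_le _ _
    _ ≤ 1 / 8 * (‖g‖ * (97 / 64)) + ‖g‖ * (33 / 64) := by
        refine add_le_add (hy.trans ?_) ?_ <;> gcongr
    _ ≤ 3 / 4 * ‖g‖ := by linarith [norm_nonneg g]

/-- On small squares far from the imaginary axis the derivative of `expFun P` has small relative
oscillation, and it is exponentially large. -/
theorem exists_norm_expFunDeriv_sub_le (P : Polynomial ℂ) (hdeg : 2 ≤ P.natDegree)
    (hP0 : P.coeff 0 ≠ 0) {r x : ℝ} (hr : 0 < r) (hrN : r ≤ 1 / (4 * (P.natDegree : ℝ)))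
    (hx : constR6 P ≤ x) (hx1 : 1 ≤ x) {p w : ℂ} (hp : ∀ z ∈ cornerSquare p r, x ≤ |z.re|)
    (hw : w ∈ cornerSquare p r) :
    ∃ L : ℂ, coeffMin P * Real.exp |w.re| ≤ ‖L‖ ∧
      ∀ z ∈ cornerSquare p r, ‖expFunDeriv P z - L‖ ≤ 3 / 4 * ‖L‖ := by
  have hlead : P.coeff P.natDegree ≠ 0 := by
    have : P ≠ 0 := by rintro rfl; simp at hdeg
    simpa using this
  have hA : 0 < ‖P.coeff P.natDegree‖ := norm_pos_iff.2 hlead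
  have hA0 : 0 < ‖P.coeff 0‖ := norm_pos_iff.2 hP0
  have hK : 0 < coeffMax P :=
    hA.trans_le (norm_coeff_le_coeffMax P (Finset.self_mem_range_succ P.natDegree))
  have hN : (2 : ℝ) ≤ P.natDegree := by exact_mod_cast hdeg
  have hN1 : (0 : ℝ) < P.natDegree - 1 := by linarith
  have hrN' : P.natDegree * r ≤ 1 / 4 := by
    rw [le_div_iff₀ (by positivity)] at hrN
    linarith
  have hr1 : r ≤ 1 / 8 := by nlinarith
  have hdist : ∀ z ∈ cornerSquare p r, ∀ m : ℂ, ‖m‖ ≤ P.natDegree → ‖m * (z - w)‖ ≤ 3 / 8 := by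
    intro z hz m hm
    rw [norm_mul]
    calc ‖m‖ * ‖z - w‖ ≤ P.natDegree * (3 / 2 * r) := by
          gcongr
          exact norm_sub_le_of_mem_cornerSquare hr.le hz hw
      _ ≤ 3 / 8 := by linarith
  rcases le_total 0 w.re with hw0 | hw0
  · have hR4 : 0 < constR4 P := by rw [constR4]; positivity
    have hm : ‖((P.natDegree : ℂ) - 1)‖ = P.natDegree - 1 := by
      rw [← Complex.ofReal_natCast, ← Complex.ofReal_one, ← Complex.ofReal_sub,
        Complex.norm_real, Real.norm_of_nonneg hN1.le]
    refine ⟨((P.natDegree : ℂ) - 1) * P.coeff P.natDegree *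
        Complex.exp (((P.natDegree : ℂ) - 1) * w), ?_, fun z hz =>
      norm_sub_le_of_norm_sub_exp_le (hdist z hz _ (by rw [hm]; linarith))
        (norm_expFunDeriv_sub_le_of_constR4_le P hdeg ?_)⟩
    · rw [norm_mul, norm_mul, hm, Complex.norm_exp, abs_of_nonneg hw0]
      have h1 : (((P.natDegree : ℂ) - 1) * w).re = ((P.natDegree : ℝ) - 1) * w.re := by
        simp [Complex.mul_re]
      rw [h1]
      calc coeffMin P * Real.exp w.re ≤
          ‖P.coeff P.natDegree‖ * Real.exp ((P.natDegree - 1) * w.re) := by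
            gcongr
            · exact min_le_right _ _
            · nlinarith
        _ ≤ (P.natDegree - 1) * ‖P.coeff P.natDegree‖ *
            Real.exp ((P.natDegree - 1) * w.re) := by
            gcongr
            nlinarith
    · have hz1 := hp z hz
      have hw1 := hp w hw
      rw [mem_cornerSquare] at hz hw
      rw [abs_of_nonneg hw0] at hw1
      -- As r < 1 ≤ x, the square cannot cross the imaginary axis, so Re z has the sign of Re w.
      rw [abs_of_nonneg (by linarith)] at hz1
      rw [← Real.exp_log hR4, Real.exp_le_exp]
      exact ((le_max_left _ _).trans hx).trans hz1
  · have hR5 : 0 < constR5 P := by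
      rw [constR5]
      refine lt_min (by positivity) (mul_pos (by positivity) (Real.sqrt_pos.2 (by positivity)))
    refine ⟨-1 * P.coeff 0 * Complex.exp (-1 * w), ?_, fun z hz =>
      norm_sub_le_of_norm_sub_exp_le (hdist z hz _ (by simp; linarith))
        (norm_expFunDeriv_sub_le_of_le_constR5 P hdeg hP0 ?_)⟩
    · rw [norm_mul, norm_mul, Complex.norm_exp, abs_of_nonpos hw0, norm_neg, norm_one, one_mul]
      have h1 : (-1 * w).re = -w.re := by simp
      rw [h1]
      gcongr
      exact min_le_left _ _
    · have hz1 := hp z hz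
      have hw1 := hp w hw
      rw [mem_cornerSquare] at hz hw
      rw [abs_of_nonpos hw0] at hw1
      rw [abs_of_nonpos (by linarith)] at hz1
      rw [← Real.exp_log hR5, Real.exp_le_exp]
      have := (le_max_right _ _).trans hx
      linarith

/-! ### Slow points and fast escape -/

/-- The points whose image is not exponentially farther from the imaginary axis. -/
def slowSet (f : ℂ → ℂ) : Set ℂ :=
  {z | |(f z).re| < 4 * Real.exp (|z.re| / 2)}

/-- The points whose orbit meets `slowSet f` during the first `n` steps. -/
def slowBefore (f : ℂ → ℂ) : ℕ → Set ℂ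
  | 0 => ∅
  | n + 1 => slowSet f ∪ f ⁻¹' slowBefore f n

theorem isOpen_slowSet {f : ℂ → ℂ} (hf : Continuous f) : IsOpen (slowSet f) :=
  isOpen_lt (by fun_prop) (by fun_prop)

theorem isOpen_slowBefore {f : ℂ → ℂ} (hf : Continuous f) (n : ℕ) : IsOpen (slowBefore f n) := by
  induction n with
  | zero => exact isOpen_empty
  | succ n ih => exact (isOpen_slowSet hf).union (ih.preimage hf)

theorem monotone_slowBefore (f : ℂ → ℂ) : Monotone (slowBefore f) := by
  refine monotone_nat_of_le_succ fun n => ?_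
  induction n with
  | zero => exact empty_subset _
  | succ n ih => exact union_subset_union_right _ (preimage_mono ih)

theorem mem_slowBefore_of_iterate_mem (f : ℂ → ℂ) (n : ℕ) (z : ℂ) (h : f^[n] z ∈ slowSet f) :
    z ∈ slowBefore f (n + 1) := by
  induction n generalizing z with
  | zero => exact Or.inl h
  | succ n ih => exact Or.inr (ih (f z) h)

/-- If the maximal modulus of `f` grows at most exponentially, then every orbit that avoids
`slowSet f` is fast escaping. -/
theorem mem_fastEscapingSet_of_notMem_slowBefore {f : ℂ → ℂ} {C M R : ℝ} (hC : 0 ≤ C) (hM0 : 0 ≤ M)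
    (hM : ∀ t, maxModulus f t ≤ C * Real.exp (M * t)) (hR : 0 ≤ R) {z : ℂ}
    (hz : z ∉ ⋃ n, slowBefore f n) : z ∈ fastEscapingSet f R := by
  have hstep : ∀ n, 4 * Real.exp (|(f^[n] z).re| / 2) ≤ |(f^[n + 1] z).re| := by
    intro n
    rw [Function.iterate_succ_apply']
    by_contra! h
    exact hz (mem_iUnion.2 ⟨n + 1, mem_slowBefore_of_iterate_mem f n z h⟩)
  -- This crude growth only serves to reach the starting threshold of `key`.
  have hlin : ∀ n : ℕ, (n : ℝ) ≤ |(f^[n] z).re| := by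
    intro n
    induction n with
    | zero => simp
    | succ n ih =>
      have h1 := hstep n
      have h2 := Real.add_one_le_exp (|(f^[n] z).re| / 2)
      push_cast
      linarith
  have hm0 : ∀ n, 0 ≤ (maxModulus f)^[n] R := by
    rintro (_ | n)
    · exact hR
    · rw [Function.iterate_succ_apply']
      exact maxModulus_nonneg _ _
  set A := 2 * (M + 1) * C with hA
  have hA0 : 0 ≤ A := by positivity
  -- Chosen so that c²/8 = c + Ac ≥ c + A, whence A + c ≤ e^{c/2} from the quadratic lower bound of
  -- exp.
  set c := 8 + 8 * A with hc
  have hc0 : 0 ≤ c := by positivity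
  have hexp : A + c ≤ Real.exp (c / 2) := by
    have := Real.quadratic_le_exp_of_nonneg (show 0 ≤ c / 2 by positivity)
    nlinarith
  obtain ⟨l, hl⟩ := exists_nat_ge (2 * (M + 1) * R + c)
  -- The slope 2(M + 1) survives the halved exponent: half of it times v is Mv + v, and e^{Mv}
  -- absorbs the growth of the maximum modulus.
  have key : ∀ n, 2 * (M + 1) * (maxModulus f)^[n] R + c ≤ |(f^[n + l] z).re| := by
    intro n
    induction n with
    | zero => rw [zero_add]; exact hl.trans (hlin l)
    | succ n ih =>
      set v := (maxModulus f)^[n] R with hv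
      have hv0 : 0 ≤ v := hm0 n
      have h1 : 1 ≤ Real.exp v := Real.one_le_exp hv0
      have h2 : 1 ≤ Real.exp (M * v) := Real.one_le_exp (by positivity)
      rw [Function.iterate_succ_apply', ← hv, Nat.succ_add]
      calc 2 * (M + 1) * maxModulus f v + c
          ≤ 2 * (M + 1) * (C * Real.exp (M * v)) + c * Real.exp (M * v) := by
            gcongr
            · exact hM v
            · nlinarith
        _ = (A + c) * Real.exp (M * v) := by rw [hA]; ring
        _ ≤ Real.exp (c / 2) * (Real.exp (M * v) * Real.exp v) := by
            gcongr
            nlinarith [Real.exp_pos (M * v)]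
        _ = Real.exp ((2 * (M + 1) * v + c) / 2) := by
            rw [← Real.exp_add, ← Real.exp_add]
            ring_nf
        _ ≤ Real.exp (|(f^[n + l] z).re| / 2) := by gcongr
        _ ≤ 4 * Real.exp (|(f^[n + l] z).re| / 2) := by linarith [Real.exp_pos (|(f^[n + l] z).re| / 2)]
        _ ≤ _ := hstep _
  refine ⟨l, fun n => ?_⟩
  have h1 := key n
  have h2 := hm0 n
  have h3 := Complex.abs_re_le_norm (f^[n + l] z)
  nlinarith

/-! ### Density of the bad points in a square -/

theorem exp_half_ge_eight {x : ℝ} (hx : 6 * Real.log 2 ≤ x) : 8 ≤ Real.exp (x / 2) := by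
  have h : (8 : ℝ) = Real.exp (3 * Real.log 2) := by
    rw [show 3 * Real.log 2 = Real.log 2 + Real.log 2 + Real.log 2 by ring, Real.exp_add,
      Real.exp_add, Real.exp_log (by norm_num)]
    norm_num
  rw [h, Real.exp_le_exp]
  linarith

/-- Closes the recursion: 1296 = 16·9² combines the area contraction 16/|L|² with the count (9|L|)²
of covering squares. -/
theorem mul_exp_neg_le {y : ℝ} (hy : 8 ≤ y) : 1296 * Real.exp (-(3 * y / 2)) ≤ 1 / (2 * y) := by
  have h1 : (2.7 : ℝ) ^ 12 ≤ Real.exp 12 := by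
    rw [show (12 : ℝ) = ((12 : ℕ) : ℝ) * 1 by norm_num, Real.exp_nat_mul]
    exact pow_le_pow_left₀ (by norm_num) (by linarith [Real.exp_one_gt_d9]) 12
  have h2 : Real.exp (3 * y / 2) = Real.exp 12 * Real.exp (3 * y / 2 - 12) := by
    rw [← Real.exp_add]
    ring_nf
  have h3 := Real.add_one_le_exp (3 * y / 2 - 12)
  have h4 : 2592 * y ≤ Real.exp (3 * y / 2) := by
    rw [h2]
    have h5 : (100000 : ℝ) ≤ Real.exp 12 := le_trans (by norm_num) h1
    have h6 : 0 ≤ Real.exp (3 * y / 2 - 12) := (Real.exp_pos _).le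
    nlinarith [mul_le_mul_of_nonneg_right h5 h6]
  rw [Real.exp_neg, ← div_eq_mul_inv, div_le_div_iff₀ (Real.exp_pos _) (by linarith)]
  linarith

/-- The area of the points in a square whose orbit meets `slowSet f`. -/
theorem volume_cornerSquare_inter_slowBefore_le {f f' : ℂ → ℂ} {r x κ T : ℝ}
    (hf : ∀ z, HasDerivAt f (f' z) z) (hr : 0 < r) (hr1 : r ≤ 1 / 8) (hx : 6 * Real.log 2 ≤ x)
    (hκ : 0 < κ) (hκx : 1 ≤ κ * Real.exp x) (hT : 3072 ≤ T * κ * r)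
    (hL : ∀ p, (∀ z ∈ cornerSquare p r, x ≤ |z.re|) → ∀ w ∈ cornerSquare p r,
      ∃ L : ℂ, κ * Real.exp |w.re| ≤ ‖L‖ ∧ ∀ z ∈ cornerSquare p r, ‖f' z - L‖ ≤ 3 / 4 * ‖L‖)
    (n : ℕ) {p w : ℂ} (hp : ∀ z ∈ cornerSquare p r, x ≤ |z.re|) (hw : w ∈ cornerSquare p r) :
    volume (cornerSquare p r ∩ slowBefore f n) ≤
      ENNReal.ofReal (T * Real.exp (-(|w.re| / 2)) * r ^ 2) := by
  have hfc : Continuous f := continuous_iff_continuousAt.2 fun z => (hf z).continuousAt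
  have hTpos : 0 < T := by
    by_contra! h
    nlinarith [mul_pos hκ hr]
  -- The base point w must vary too: the inductive bound is applied to image squares at a point v
  -- with |Re v| ≥ 3y.
  induction n generalizing p w with
  | zero => simp [slowBefore]
  | succ n ih =>
  obtain ⟨L, hLw, hLp⟩ := hL p hp w hw
  set y := Real.exp (|w.re| / 2) with hy
  have hwx := hp w hw
  have hy8 : 8 ≤ y := exp_half_ge_eight (hx.trans hwx)
  have hyy : Real.exp |w.re| = y ^ 2 := by
    rw [hy, ← Real.exp_nat_mul]
    congr 1
    push_cast
    ring
  have hyneg : Real.exp (-(|w.re| / 2)) = 1 / y := by rw [Real.exp_neg, one_div]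
  have hL1 : 1 ≤ ‖L‖ := by
    refine (hκx.trans ?_).trans hLw
    gcongr
  have hL0 : L ≠ 0 := norm_pos_iff.1 (by linarith)
  set D := 3 * ‖L‖ * r with hD
  have hDpos : 0 < D := by positivity
  have himage : ∀ z ∈ cornerSquare p r, ‖f z - f w‖ ≤ D := by
    intro z hz
    have h1 := norm_image_sub_sub_mul_le (convex_cornerSquare p r) (fun u _ => hf u) hLp hw hz
    have h2 : ‖f z - f w‖ ≤ ‖f z - f w - L * (z - w)‖ + ‖L * (z - w)‖ := by
      simpa using norm_add_le (f z - f w - L * (z - w)) (L * (z - w))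
    rw [norm_mul] at h2
    have h3 := norm_sub_le_of_mem_cornerSquare hr.le hz hw
    calc ‖f z - f w‖ ≤ 2 * ‖L‖ * ‖z - w‖ := by
          nlinarith [mul_nonneg (norm_nonneg L) (norm_nonneg (z - w))]
      _ ≤ 2 * ‖L‖ * (3 / 2 * r) := by gcongr
      _ = D := by rw [hD]; ring
  have hre : ∀ z ∈ cornerSquare p r, |(|z.re| - |w.re|)| ≤ 1 / 8 := by
    intro z hz
    rw [mem_cornerSquare] at hz hw
    refine (abs_abs_sub_abs_le_abs_sub z.re w.re).trans (abs_le.2 ⟨?_, ?_⟩) <;> linarith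
  -- Since |Re z|/2 varies by at most 1/16 on the square, 4e^{|Re z|/2} stays between 3y and 8y.
  have hexp16 : Real.exp (1 / 16) ≤ 4 / 3 := by
    have h1 := Real.add_one_le_exp (-(1 / 16) : ℝ)
    rw [Real.exp_neg] at h1
    have h2 : (3 / 4 : ℝ) ≤ (Real.exp (1 / 16))⁻¹ := by linarith
    rw [le_inv_comm₀ (by norm_num) (Real.exp_pos _)] at h2
    linarith
  -- Slow points and later visits each receive half of the budget Tr²/y; here 3072 ≤ Tκr is what
  -- makes the half suffice.
  have hslow : volume (cornerSquare p r ∩ slowSet f) ≤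
      ENNReal.ofReal (T * (1 / (2 * y)) * r ^ 2) := by
    have hmaps : MapsTo f (cornerSquare p r ∩ slowSet f)
        (Icc (-(8 * y)) (8 * y) ×ℂ Icc ((f w).im - D) ((f w).im + D)) := by
      rintro z ⟨hz, hzs⟩
      have h1 := (Complex.abs_im_le_norm _).trans (himage z hz)
      rw [Complex.sub_im, abs_le] at h1
      have h2 : |(f z).re| ≤ 8 * y := by
        refine (le_of_lt hzs).trans ?_
        have h3 : Real.exp (|z.re| / 2) ≤ y * Real.exp (1 / 16) := by
          rw [hy, ← Real.exp_add, Real.exp_le_exp]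
          linarith [(abs_le.1 (hre z hz)).2]
        nlinarith
      rw [abs_le] at h2
      exact ⟨⟨h2.1, h2.2⟩, by linarith [h1.1], by linarith [h1.2]⟩
    refine (volume_le_of_norm_deriv_sub_le (convex_cornerSquare p r) hf hL0 hLp
      ((measurableSet_cornerSquare p r).inter (isOpen_slowSet hfc).measurableSet)
      inter_subset_left hmaps).trans ?_
    rw [Complex.volume_reProdIm measurableSet_Icc measurableSet_Icc, Real.volume_Icc,
      Real.volume_Icc, ← ENNReal.ofReal_mul (by linarith), ← ENNReal.ofReal_mul (by positivity)]
    refine ENNReal.ofReal_le_ofReal ?_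
    have h1 : 16 / ‖L‖ ^ 2 * ((8 * y - -(8 * y)) * ((f w).im + D - ((f w).im - D))) =
        1536 * y * r / ‖L‖ := by
      rw [hD]
      field_simp
      ring
    rw [hyy] at hLw
    rw [h1, div_le_iff₀ (by linarith)]
    calc 1536 * y * r ≤ (T * κ * r) / 2 * y * r := by gcongr; linarith
      _ = T * (1 / (2 * y)) * r ^ 2 * (κ * y ^ 2) := by field_simp
      _ ≤ _ := by gcongr
  have hfast : volume ((cornerSquare p r ∩ f ⁻¹' slowBefore f n) \ slowSet f) ≤
      ENNReal.ofReal (T * (1 / (2 * y)) * r ^ 2) := by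
    set q : ℂ := ⟨(f w).re - D, (f w).im - D⟩ with hq
    have hmaps : MapsTo f ((cornerSquare p r ∩ f ⁻¹' slowBefore f n) \ slowSet f)
        (cornerSquare q (2 * D) ∩ (slowBefore f n ∩ {v | 3 * y ≤ |v.re|})) := by
      rintro z ⟨⟨hz, hzb⟩, hzs⟩
      have h1 := (Complex.abs_im_le_norm _).trans (himage z hz)
      have h2 := (Complex.abs_re_le_norm _).trans (himage z hz)
      rw [Complex.sub_im, abs_le] at h1
      rw [Complex.sub_re, abs_le] at h2
      refine ⟨?_, hzb, ?_⟩
      · rw [mem_cornerSquare, hq]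
        dsimp only
        refine ⟨⟨?_, ?_⟩, ?_, ?_⟩ <;> linarith
      · refine le_trans ?_ (not_lt.1 (show ¬|(f z).re| < 4 * Real.exp (|z.re| / 2) from hzs))
        have h3 : y ≤ Real.exp (|z.re| / 2) * Real.exp (1 / 16) := by
          rw [hy, ← Real.exp_add, Real.exp_le_exp]
          linarith [(abs_le.1 (hre z hz)).1]
        nlinarith [Real.exp_pos (|z.re| / 2)]
    refine (volume_le_of_norm_deriv_sub_le (convex_cornerSquare p r) hf hL0 hLp
      (((measurableSet_cornerSquare p r).inter
        ((isOpen_slowBefore hfc n).preimage hfc).measurableSet).diff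
        (isOpen_slowSet hfc).measurableSet)
      (sdiff_subset.trans inter_subset_left) hmaps).trans ?_
    have hsmall : ∀ p', volume (cornerSquare p' r ∩ (slowBefore f n ∩ {v | 3 * y ≤ |v.re|})) ≤
        ENNReal.ofReal (T * Real.exp (-(3 * y / 2)) * r ^ 2) := by
      intro p'
      rcases eq_empty_or_nonempty (cornerSquare p' r ∩ (slowBefore f n ∩ {v | 3 * y ≤ |v.re|}))
        with hempty | ⟨v, hv, -, hvy⟩
      · rw [hempty]; simp
      have hvy' : 3 * y ≤ |v.re| := hvy
      -- Squares meeting |Re| ≥ 3y still lie beyond x, because 3y - r ≥ 3(|Re w|/2 + 1) - r ≥ |Re w|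
      -- ≥ x.
      have hp' : ∀ z ∈ cornerSquare p' r, x ≤ |z.re| := by
        intro z hz
        rw [mem_cornerSquare] at hz hv
        have h1 : |v.re| - |z.re| ≤ r :=
          (abs_sub_abs_le_abs_sub _ _).trans (abs_le.2 ⟨by linarith, by linarith⟩)
        have h2 := Real.add_one_le_exp (|w.re| / 2)
        linarith
      refine (measure_mono (inter_subset_inter_right _ inter_subset_left)).trans
        ((ih hp' hv).trans (ENNReal.ofReal_le_ofReal ?_))
      gcongr
    refine (mul_le_mul_right (volume_box_inter_le hr hsmall q) _).trans ?_
    rw [← ENNReal.ofReal_natCast, ← ENNReal.ofReal_pow (Nat.cast_nonneg _),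
      ← ENNReal.ofReal_mul (by positivity), ← ENNReal.ofReal_mul (by positivity)]
    refine ENNReal.ofReal_le_ofReal ?_
    -- The count is at most 6|L| + 1, and |L| ≥ 1.
    have hn : ((⌊2 * D / r⌋₊ + 1 : ℕ) : ℝ) ≤ 9 * ‖L‖ := by
      have h1 := floor_add_one_mul_le hr (show 0 ≤ 2 * D by positivity)
      refine le_of_mul_le_mul_right (h1.trans ?_) hr
      rw [hD]
      nlinarith
    calc _ ≤ 16 / ‖L‖ ^ 2 * ((9 * ‖L‖) ^ 2 * (T * Real.exp (-(3 * y / 2)) * r ^ 2)) := by gcongr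
      _ = T * (1296 * Real.exp (-(3 * y / 2))) * r ^ 2 := by
        field_simp
        norm_num
      _ ≤ T * (1 / (2 * y)) * r ^ 2 := by
        gcongr
        exact mul_exp_neg_le hy8
  have hcover : cornerSquare p r ∩ slowBefore f (n + 1) ⊆ (cornerSquare p r ∩ slowSet f) ∪
      ((cornerSquare p r ∩ f ⁻¹' slowBefore f n) \ slowSet f) := by
    rintro z ⟨hz, hzs | hzs⟩
    · exact Or.inl ⟨hz, hzs⟩
    · by_cases h : z ∈ slowSet f
      · exact Or.inl ⟨hz, h⟩
      · exact Or.inr ⟨⟨hz, hzs⟩, h⟩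
  refine (measure_mono hcover).trans ((measure_union_le _ _).trans
    ((add_le_add hslow hfast).trans ?_))
  rw [← ENNReal.ofReal_add (by positivity) (by positivity), hyneg]
  refine ENNReal.ofReal_le_ofReal (le_of_eq ?_)
  field_simp
  norm_num

/-! ### Summation over a horizontal strip -/

theorem tsum_ofReal_exp_geometric {c r : ℝ} (hc : 0 ≤ c) (hr : 0 < r) :
    ∑' k : ℕ, ENNReal.ofReal (c * Real.exp (-(k * r / 2))) =
      ENNReal.ofReal (c / (1 - Real.exp (-r / 2))) := by
  have h1 : Real.exp (-r / 2) < 1 := by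
    rw [← Real.exp_zero, Real.exp_lt_exp]
    linarith
  have h : ∀ k : ℕ, c * Real.exp (-(k * r / 2)) = c * Real.exp (-r / 2) ^ k := by
    intro k
    rw [← Real.exp_nat_mul]
    ring_nf
  simp_rw [h]
  rw [← ENNReal.ofReal_tsum_of_nonneg (fun k => by positivity)
    ((summable_geometric_of_lt_one (Real.exp_pos _).le h1).mul_left c), tsum_mul_left,
    tsum_geometric_of_lt_one (Real.exp_pos _).le h1, ← div_eq_mul_inv]

/-- A set whose density in squares of side `r` decays exponentially with the distance from the
imaginary axis has finite area in each horizontal strip. -/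
theorem volume_horizontalStrip_inter_le {B : Set ℂ} {r x T : ℝ} (hr : 0 < r) (hx : 0 < x)
    (hT : 0 ≤ T)
    (hB : ∀ p w, (∀ z ∈ cornerSquare p r, x ≤ |z.re|) → w ∈ cornerSquare p r →
      volume (cornerSquare p r ∩ B) ≤ ENNReal.ofReal (T * Real.exp (-(|w.re| / 2)) * r ^ 2))
    (a : ℝ) :
    volume (horizontalStrip a ∩ B) ≤ ENNReal.ofReal ((4 * Real.pi + 4 * r) *
      (x + r + T * Real.exp (-(x / 2)) * (r / (1 - Real.exp (-r / 2))))) := by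
  have hpi := Real.pi_pos
  set m := ⌊2 * Real.pi / r⌋₊ + 1 with hm
  have hmr : (m : ℝ) * r ≤ 2 * Real.pi + r := floor_add_one_mul_le hr (by positivity)
  set right : ℕ → ℕ → ℂ := fun k j => ⟨x + k * r, a + j * r⟩ with hright
  set left : ℕ → ℕ → ℂ := fun k j => ⟨-(x + k * r) - r, a + j * r⟩ with hleft
  have hcover : horizontalStrip a ∩ B ⊆
      (Icc (-x) x ×ℂ Icc a (a + 2 * Real.pi)) ∪ ⋃ k : ℕ, ⋃ j ∈ Finset.range m,
        (cornerSquare (right k j) r ∩ B) ∪ (cornerSquare (left k j) r ∩ B) := by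
    rintro z ⟨⟨hz1, hz2⟩, hzB⟩
    by_cases hzx : |z.re| ≤ x
    · exact Or.inl ⟨abs_le.1 hzx, hz1, hz2⟩
    · refine Or.inr ?_
      push Not at hzx
      obtain ⟨j, hj, hj1, hj2⟩ := exists_nat_mul_le hr (sub_nonneg.2 hz1)
        (by linarith : z.im - a ≤ 2 * Real.pi)
      obtain ⟨k, -, hk1, hk2⟩ := exists_nat_mul_le hr (sub_nonneg.2 hzx.le) le_rfl
      simp only [mem_iUnion, Finset.mem_range]
      refine ⟨k, j, hj, ?_⟩
      rcases le_total 0 z.re with h0 | h0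
      · rw [abs_of_nonneg h0] at hk1 hk2
        refine Or.inl ⟨?_, hzB⟩
        rw [mem_cornerSquare, hright]
        dsimp only
        refine ⟨⟨?_, ?_⟩, ?_, ?_⟩ <;> linarith
      · rw [abs_of_nonpos h0] at hk1 hk2
        refine Or.inr ⟨?_, hzB⟩
        rw [mem_cornerSquare, hleft]
        dsimp only
        refine ⟨⟨?_, ?_⟩, ?_, ?_⟩ <;> linarith
  have hkr : ∀ k : ℕ, 0 ≤ (k : ℝ) * r := fun k => by positivity
  have hR : ∀ k j, volume (cornerSquare (right k j) r ∩ B) ≤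
      ENNReal.ofReal (T * Real.exp (-((x + k * r) / 2)) * r ^ 2) := by
    intro k j
    have h := hB (right k j) (right k j) ?_ ?_
    · rwa [hright, abs_of_nonneg (by linarith [hkr k])] at h
    · intro z hz
      rw [mem_cornerSquare, hright] at hz
      dsimp only at hz
      exact le_abs.2 (Or.inl (by linarith [hkr k]))
    · rw [mem_cornerSquare]
      refine ⟨⟨?_, ?_⟩, ?_, ?_⟩ <;> linarith
  have hLft : ∀ k j, volume (cornerSquare (left k j) r ∩ B) ≤
      ENNReal.ofReal (T * Real.exp (-((x + k * r) / 2)) * r ^ 2) := by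
    intro k j
    -- The lower right corner, on the side nearest the axis, gives the same exponent as in the right
    -- half-plane.
    have h := hB (left k j) ⟨-(x + k * r), a + j * r⟩ ?_ ?_
    · rwa [abs_neg, abs_of_nonneg (by linarith [hkr k])] at h
    · intro z hz
      rw [mem_cornerSquare, hleft] at hz
      dsimp only at hz
      exact le_abs.2 (Or.inr (by linarith [hkr k]))
    · rw [mem_cornerSquare, hleft]
      dsimp only
      refine ⟨⟨?_, ?_⟩, ?_, ?_⟩ <;> linarith
  set Q := T * Real.exp (-(x / 2)) with hQ
  have hQ0 : 0 ≤ Q := by positivity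
  have hcol : ∀ k : ℕ, volume (⋃ j ∈ Finset.range m,
      (cornerSquare (right k j) r ∩ B) ∪ (cornerSquare (left k j) r ∩ B)) ≤
      ENNReal.ofReal ((4 * Real.pi + 4 * r) * (Q * r) * Real.exp (-(k * r / 2))) := by
    intro k
    set b := T * Real.exp (-((x + k * r) / 2)) * r ^ 2 with hb
    have hb0 : 0 ≤ b := by positivity
    have hbQ : b = Q * Real.exp (-(k * r / 2)) * r ^ 2 := by
      rw [hb, hQ, show -((x + k * r) / 2) = -(x / 2) + -(k * r / 2) by ring, Real.exp_add]
      ring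
    calc _ ≤ ∑ j ∈ Finset.range m, (ENNReal.ofReal b + ENNReal.ofReal b) :=
          (measure_biUnion_finset_le _ _).trans (Finset.sum_le_sum fun j _ =>
            (measure_union_le _ _).trans (add_le_add (hR k j) (hLft k j)))
      _ = ENNReal.ofReal (m * (2 * b)) := by
          rw [Finset.sum_const, Finset.card_range, nsmul_eq_mul, ← ENNReal.ofReal_add hb0 hb0,
            ← two_mul, ENNReal.ofReal_mul (Nat.cast_nonneg m), ENNReal.ofReal_natCast]
      _ ≤ _ := by
          refine ENNReal.ofReal_le_ofReal ?_
          rw [hbQ]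
          -- Two sides with m squares each: 2mr ≤ 4π + 2r.
          calc _ = (2 * (m * r)) * (Q * r) * Real.exp (-(k * r / 2)) := by ring
            _ ≤ _ := by gcongr; linarith
  have hden : 0 < 1 - Real.exp (-r / 2) := sub_pos.2 (by rw [← Real.exp_zero, Real.exp_lt_exp]; linarith)
  have hcentral : volume (Icc (-x) x ×ℂ Icc a (a + 2 * Real.pi)) ≤
      ENNReal.ofReal ((4 * Real.pi + 4 * r) * (x + r)) := by
    rw [Complex.volume_reProdIm measurableSet_Icc measurableSet_Icc, Real.volume_Icc,
      Real.volume_Icc, ← ENNReal.ofReal_mul (by linarith)]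
    refine ENNReal.ofReal_le_ofReal ?_
    nlinarith [mul_pos hr hx, mul_pos hr hr, mul_pos hpi hr]
  calc _ ≤ _ := measure_mono hcover
    _ ≤ ENNReal.ofReal ((4 * Real.pi + 4 * r) * (x + r)) + ∑' k : ℕ,
        ENNReal.ofReal ((4 * Real.pi + 4 * r) * (Q * r) * Real.exp (-(k * r / 2))) :=
        (measure_union_le _ _).trans (add_le_add hcentral
          ((measure_iUnion_le _).trans (ENNReal.tsum_le_tsum hcol)))
    _ = _ := by
        rw [tsum_ofReal_exp_geometric (by positivity) hr,
          ← ENNReal.ofReal_add (by positivity) (by positivity)]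
        congr 1
        ring

/-! ### Matching the constants -/

theorem theorem3p1 (P : Polynomial ℂ) (hdeg : 2 ≤ P.natDegree) (hP0 : P.eval 0 ≠ 0)
    (R : ℝ) (hR : 0 < R)
    (hMR : Filter.Tendsto (fun n : ℕ => (maxModulus (expFun P))^[n] R) Filter.atTop Filter.atTop)
    (r c₁ x : ℝ) (hr : 0 < r) (hrN : r ≤ 1 / (4 * (P.natDegree : ℝ)))
    (hc : constC0 P r ≤ c₁)
    (hx : max (max (constR3 P) (constR6 P)) (max (6 * Real.log 2) (12 + 2 * Real.log c₁)) ≤ x)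
    (a : ℝ) :
    MeasureTheory.volume (horizontalStrip a ∩ (fastEscapingSet (expFun P) R)ᶜ)
        ≤ ENNReal.ofReal (areaBound r c₁ x) ∧
      MeasureTheory.volume (horizontalStrip a ∩ (fastEscapingSet (expFun P) R)ᶜ) < ⊤ := by
  suffices h : volume (horizontalStrip a ∩ (fastEscapingSet (expFun P) R)ᶜ)
      ≤ ENNReal.ofReal (areaBound r c₁ x) from ⟨h, h.trans_lt ENNReal.ofReal_lt_top⟩
  simp only [max_le_iff] at hx
  obtain ⟨⟨-, hx6⟩, hxlog, hxc⟩ := hx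
  have hP0' : P.coeff 0 ≠ 0 := by rwa [Polynomial.coeff_zero_eq_eval_zero]
  have hlead : P.coeff P.natDegree ≠ 0 := by
    have : P ≠ 0 := by rintro rfl; simp at hdeg
    simpa using this
  have hN : (2 : ℝ) ≤ P.natDegree := by exact_mod_cast hdeg
  have hr1 : r ≤ 1 / 8 := by
    refine hrN.trans ?_
    rw [div_le_div_iff₀ (by positivity) (by norm_num)]
    linarith
  have hκ : 0 < coeffMin P := lt_min (norm_pos_iff.2 hP0') (norm_pos_iff.2 hlead)
  have hK : 0 ≤ coeffMax P := (norm_nonneg _).trans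
    (norm_coeff_le_coeffMax P (Finset.self_mem_range_succ P.natDegree))
  have hsqrt : 1 ≤ Real.sqrt 2 := Real.one_le_sqrt.2 (by norm_num)
  have hc1 : 32 / (coeffMin P * r) ≤ c₁ := by
    refine le_trans ?_ hc
    have h1 : 0 ≤ 1 / (4 * coeffMin P ^ 2) + 12 * Real.sqrt 2 / coeffMin P := by positivity
    have h2 : 32 / (coeffMin P * r) ≤ 32 * Real.sqrt 2 / (coeffMin P * r) := by
      gcongr
      linarith
    rw [constC0, add_assoc]
    linarith
  rw [div_le_iff₀ (by positivity)] at hc1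
  have hc0 : 0 < c₁ := by
    by_contra! h
    nlinarith [mul_pos hκ hr]
  have hx1 : 1 ≤ x := by linarith [Real.log_two_gt_d9]
  have hκx : 1 ≤ coeffMin P * Real.exp x := by
    have h1 : c₁ ≤ Real.exp x := by
      have h2 : c₁ = Real.exp (Real.log c₁) := (Real.exp_log hc0).symm
      rw [h2, Real.exp_le_exp]
      linarith
    have h3 : 1 ≤ coeffMin P * c₁ := by nlinarith [mul_pos hκ hc0]
    nlinarith
  -- With this T, Te^{-x/2} is the factor 8c₁e^{4 - x/2} of `areaBound`.
  set T := 8 * c₁ * Real.exp 4 with hT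
  have hT0 : 0 ≤ T := by positivity
  have hTκ : 3072 ≤ T * coeffMin P * r := by
    have h1 : (2.7 : ℝ) ^ 4 ≤ Real.exp 4 := by
      rw [show (4 : ℝ) = ((4 : ℕ) : ℝ) * 1 by norm_num, Real.exp_nat_mul]
      exact pow_le_pow_left₀ (by norm_num) (by linarith [Real.exp_one_gt_d9]) 4
    have h2 : (50 : ℝ) ≤ Real.exp 4 := le_trans (by norm_num) h1
    calc (3072 : ℝ) ≤ 8 * 50 * 32 := by norm_num
      _ ≤ 8 * Real.exp 4 * (c₁ * (coeffMin P * r)) := by gcongr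
      _ = T * coeffMin P * r := by rw [hT]; ring
  have hbad := fun n p w hp hw => volume_cornerSquare_inter_slowBefore_le (x := x)
    (hasDerivAt_expFun P) hr hr1 hxlog hκ hκx hTκ
    (fun p hp w hw => exists_norm_expFunDeriv_sub_le P hdeg hP0' hr hrN hx6 hx1 hp hw)
    n (p := p) (w := w) hp hw
  have hsub : (fastEscapingSet (expFun P) R)ᶜ ⊆ ⋃ n, slowBefore (expFun P) n := by
    intro z hz
    by_contra h
    exact hz (mem_fastEscapingSet_of_notMem_slowBefore (by positivity) (by linarith)
      (maxModulus_expFun_le P hdeg) hR.le h)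
  refine (measure_mono (inter_subset_inter_right _ hsub)).trans
    ((volume_horizontalStrip_inter_le hr (by linarith) hT0 (x := x) ?_ a).trans (le_of_eq ?_))
  · intro p w hp hw
    -- The bound is uniform in n, so continuity from below passes it to the increasing union.
    rw [inter_iUnion, Monotone.measure_iUnion fun i j hij =>
      inter_subset_inter_right _ (monotone_slowBefore _ hij)]
    exact iSup_le fun n => hbad n p w hp hw
  · rw [areaBound, hT, sub_eq_add_neg 4 (x / 2), Real.exp_add]
    ring_nf
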